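/- Let $h\colon\mathbb{R}\to\mathbb{R}$ be real analytic on $\mathbb{R}$, Lipschitz continuous, and not a polynomial. For $l\ge 1$ let $S_{h,l}^{n,m}$ denote the set of feedforward neural networks $\mathbb{R}^n\to\mathbb{R}^m$ with $l$ hidden layers and activation $h$, i.e. the maps $A_{l}\circ h\circ A_{l-1}\circ h\circ\cdots\circ h\circ A_0$, where $h$ is applied componentwise, $A_0,\dots,A_l$ are affine maps $A_i\colon\mathbb{R}^{d_i}\to\mathbb{R}^{d_{i+1}}$ with $d_0=n$, $d_{l+1}=m$, and the widths $d_1,\dots,d_l\ge 1$ of the hidden layers are arbitrary. Let $k,n_1,\dots,n_k$ be positive integers and let $K_j\subset\mathbb{R}^{n_j}$ be compact for $j=1,\dots,k$. Let $\mathcal{P}(K_j)$ be the space of Borel probability measures on $K_j$ with the weak topology, and give $\prod_{j=1}^k\mathcal{P}(K_j)$ the product topology. Fix any positive integers $l,l_1,\dots,l_k$, and let $\mathcal{H}$ be the set of all functions on $\prod_{j=1}^k\mathcal{P}(K_j)$ of the form $$(P_1,\dots,P_k)\mapsto g\big(\mathbb{E}_{P_1}[f_1],\dots,\mathbb{E}_{P_k}[f_k]\big),\qquad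 \mathbb{E}_{P_j}[f_j]=\int_{K_j} f_j\,dP_j,$$ with arbitrary positive integers $m_1,\dots,m_k$, $m:=\sum_{j=1}^k m_j$, $f_j\in S_{h,l_j}^{n_j,m_j}$ for each $j$, and $g\in S_{h,l}^{m,1}$. Then $\mathcal{H}$ is contained in the space $C\big(\prod_{j=1}^k\mathcal{P}(K_j);\mathbb{R}\big)$ of real-valued continuous functions and is dense in it with respect to the uniform norm. -/

import Mathlib

open MeasureTheory TopologicalSpace

noncomputable section

/-- `networks h l n m` is the set of feedforward neural networks `ℝⁿ → ℝᵐ` with `l` hidden layers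
and activation `h`: alternately an affine map (weights and biases) and the componentwise
application of `h`, ending with an affine map, the hidden layers having arbitrary positive
widths. -/
def networks (h : ℝ → ℝ) : ℕ → (n m : ℕ) → Set ((Fin n → ℝ) → (Fin m → ℝ))
  | 0, n, m =>
      {f | ∃ (W : Matrix (Fin m) (Fin n) ℝ) (b : Fin m → ℝ), f = fun x => W.mulVec x + b}
  | l + 1, n, m =>
      {f | ∃ d : ℕ, 0 < d ∧ ∃ φ ∈ networks h l n d,
        ∃ (W : Matrix (Fin m) (Fin d) ℝ) (b : Fin m → ℝ),
          f = fun x => W.mulVec (fun i => h (φ x i)) + b}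

/-- The concatenation `(v₁, …, v_k) ∈ ℝ^{m₁ + ⋯ + m_k}` of vectors `v_j ∈ ℝ^{m_j}`. -/
def concat {k : ℕ} {m : Fin k → ℕ} (v : ∀ j, Fin (m j) → ℝ) : Fin (∑ j, m j) → ℝ :=
  fun i => v (finSigmaFinEquiv.symm i).1 (finSigmaFinEquiv.symm i).2

/-- The functions `(P₁, …, P_k) ↦ g (E_{P₁}[f₁], …, E_{P_k}[f_k])` on `∏ⱼ 𝒫(K_j)`, where
`f_j : ℝ^{n_j} → ℝ^{m_j}` is a network with `L j` hidden layers, `g : ℝ^m → ℝ` is a network with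
`l` hidden layers (a map to `ℝ` is a map to `ℝ¹`), `m = m₁ + ⋯ + m_k`, and the positive output
dimensions `m_j` are arbitrary. -/
def measureNetworks (h : ℝ → ℝ) {k : ℕ} {n : Fin k → ℕ} (K : ∀ j, Compacts (Fin (n j) → ℝ))
    (l : ℕ) (L : Fin k → ℕ) : Set ((∀ j, ProbabilityMeasure (K j)) → ℝ) :=
  {H | ∃ m : Fin k → ℕ, (∀ j, 0 < m j) ∧
    ∃ f : ∀ j, (Fin (n j) → ℝ) → (Fin (m j) → ℝ), (∀ j, f j ∈ networks h (L j) (n j) (m j)) ∧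
    ∃ g ∈ networks h l (∑ j, m j) 1,
      ∀ P, H P = g (concat fun j => ∫ x : K j, f j x ∂(P j : Measure (K j))) 0}

end

/-! Universal approximation is proved on a compact Hausdorff space for any linear space `B` of
continuous input functions that contains `1` and separates points. One layer (`dense_span_comp`):
the closed span of the `h ∘ u`, `u ∈ B`, absorbs derivatives along `u + t v`, hence contains `v ^ k
* h⁽ᵏ⁾ ∘ u`. As no `h⁽ᵏ⁾` vanishes identically, a constant `u` yields every `v ^ k`, then `exp v`,
and Stone–Weierstrass applies. More layers (`dense_netSpan`): a dense space containing `1` is again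
an admissible `B`. The result is used twice: on each `K j` with affine inputs, and on `∏ⱼ 𝒫(K_j)`
with sums of expectations of networks. The latter separate points because integrals of continuous
functions determine a measure and networks are dense among these. -/

open Filter Topology in
/-- If `h` has the continuous derivative `h'`, then `t ↦ w * h ∘ (u + t v)` has at `t = 0` the
derivative `w * v * h' ∘ u` in the Banach space `C(X, ℝ)`. -/
theorem hasDerivAt_mul_comp_add_smul {X : Type*} [TopologicalSpace X] [CompactSpace X]
    (h h' : C(ℝ, ℝ)) (hd : ∀ x, HasDerivAt h (h' x) x) (u v w : C(X, ℝ)) :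
    HasDerivAt (fun t : ℝ => w * h.comp (u + t • v)) (w * v * h'.comp u) 0 := by
  let G : ℝ → C(X, ℝ) := fun s => w * v * h'.comp (u + s • v)
  have hG : Continuous G := by
    apply ContinuousMap.continuous_of_continuous_uncurry
    simp only [G, Function.uncurry_def]
    simp only [ContinuousMap.mul_apply, ContinuousMap.comp_apply, ContinuousMap.add_apply,
      ContinuousMap.smul_apply, smul_eq_mul]
    fun_prop
  have hG0 : G 0 = w * v * h'.comp u := by simp [G]
  rw [hasDerivAt_iff_tendsto_slope, Metric.tendsto_nhds]
  intro ε hε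
  have := Metric.continuous_iff.1 hG 0 (ε / 2) (half_pos hε)
  obtain ⟨δ, hδ, H⟩ := this
  rw [eventually_nhdsWithin_iff]
  filter_upwards [Metric.ball_mem_nhds (0 : ℝ) hδ] with t ht ht0
  have ht0' : t ≠ 0 := ht0
  refine lt_of_le_of_lt ((ContinuousMap.dist_le (half_pos hε).le).2 fun x => ?_) (half_lt_self hε)
  -- Mean value theorem at each `x`: the slope minus the derivative is `G s x - G 0 x` with `|s| ≤
  -- |t|`. Here `s` depends on `x`, but continuity of `G` in sup norm makes the bound uniform.
  obtain ⟨s, hs, hs'⟩ : ∃ s : ℝ, |s| ≤ |t| ∧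
      h (u x + t * v x) - h (u x) = t * v x * h' (u x + s * v x) := by
    have hdF : ∀ s, HasDerivAt (fun s : ℝ => h (u x + s * (t * v x)))
        (h' (u x + s * (t * v x)) * (t * v x)) s := by
      intro s
      have h1 : HasDerivAt (fun s : ℝ => u x + s * (t * v x)) (t * v x) s := by
        simpa using ((hasDerivAt_id s).mul_const (t * v x)).const_add (u x)
      exact (hd _).comp s h1
    obtain ⟨c, hc, hc'⟩ := exists_hasDerivAt_eq_slope _ _ (zero_lt_one' ℝ)
      (continuous_iff_continuousAt.2 fun s => (hdF s).continuousAt).continuousOn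
      fun s _ => hdF s
    refine ⟨c * t, ?_, ?_⟩
    · rw [abs_mul, abs_of_pos hc.1]
      exact mul_le_of_le_one_left (abs_nonneg _) hc.2.le
    · simp only [one_mul, zero_mul, add_zero, sub_zero, div_one] at hc'
      rw [← hc', ← mul_assoc c]
      ring
  have hGs : dist (G s) (G 0) < ε / 2 := H s (lt_of_le_of_lt (by simpa using hs) ht)
  refine le_trans (le_of_eq ?_) ((ContinuousMap.dist_apply_le_dist x).trans hGs.le)
  rw [hG0]
  congr 1
  simp only [slope, vsub_eq_sub, sub_zero, zero_smul, add_zero, G, ContinuousMap.smul_apply,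
    ContinuousMap.sub_apply, ContinuousMap.mul_apply, ContinuousMap.comp_apply,
    ContinuousMap.add_apply, smul_eq_mul]
  rw [← mul_sub, hs']
  field_simp

/-- A smooth function one of whose iterated derivatives vanishes identically is a polynomial. -/
theorem exists_polynomial_of_iteratedDeriv_eq_zero (k : ℕ) :
    ∀ h : ℝ → ℝ, ContDiff ℝ (⊤ : ℕ∞) h → (∀ x, iteratedDeriv k h x = 0) →
      ∃ p : Polynomial ℝ, ∀ x, h x = p.eval x := by
  induction k with
  | zero => exact fun h _ h0 => ⟨0, fun x => by simpa using h0 x⟩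
  | succ k ih =>
    intro h hh h0
    have hh' : Differentiable ℝ h ∧ ContDiff ℝ (⊤ : ℕ∞) (deriv h) := contDiff_infty_iff_deriv.1 hh
    obtain ⟨p, hp⟩ := ih (deriv h) hh'.2 fun x => by rw [← iteratedDeriv_succ']; exact h0 x
    let q : Polynomial ℝ := ∑ i ∈ Finset.range (p.natDegree + 1),
      Polynomial.C (p.coeff i / (i + 1)) * Polynomial.X ^ (i + 1)
    have hq : q.derivative = p := by
      conv_rhs => rw [p.as_sum_range_C_mul_X_pow]
      simp only [q, Polynomial.derivative_sum, Polynomial.derivative_C_mul,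
        Polynomial.derivative_X_pow]
      refine Finset.sum_congr rfl fun i _ => ?_
      rw [← mul_assoc, ← Polynomial.C_mul, Nat.add_sub_cancel]
      congr 2
      push_cast
      field_simp
    have hc : ∀ x, h x - q.eval x = h 0 - q.eval 0 := fun x =>
      is_const_of_deriv_eq_zero (f := fun x => h x - q.eval x) (hh'.1.sub q.differentiable)
        (fun y => by
          rw [deriv_fun_sub (hh'.1 y) q.differentiableAt, Polynomial.deriv, hq, hp, sub_self]) x 0
    exact ⟨q + Polynomial.C (h 0 - q.eval 0), fun x => by
      rw [Polynomial.eval_add, Polynomial.eval_C, ← hc x]; ring⟩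

/-- If `h` is smooth and not a polynomial, then the functions `h ∘ u`, for `u` in a linear space of
continuous functions that contains the constants and separates points, span a dense subspace. -/
theorem dense_span_comp {X : Type*} [TopologicalSpace X] [CompactSpace X]
    (h : C(ℝ, ℝ)) (hs : ContDiff ℝ (⊤ : ℕ∞) h)
    (hp : ¬ ∃ p : Polynomial ℝ, ∀ x, h x = p.eval x) (B : Submodule ℝ C(X, ℝ))
    (hone : (1 : C(X, ℝ)) ∈ B) (hsep : ∀ x y, x ≠ y → ∃ v ∈ B, v x ≠ v y) :
    Dense (Submodule.span ℝ ((fun u => h.comp u) '' (B : Set C(X, ℝ))) : Set C(X, ℝ)) := by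
  set M := (Submodule.span ℝ ((fun u => h.comp u) '' (B : Set C(X, ℝ)))).topologicalClosure with hM
  have hMc : IsClosed (M : Set C(X, ℝ)) := Submodule.isClosed_topologicalClosure _
  let D : ℕ → C(ℝ, ℝ) := fun k => ⟨iteratedDeriv k h, hs.continuous_iteratedDeriv k (by
    exact_mod_cast le_top)⟩
  have hD : ∀ k x, HasDerivAt (D k) (D (k + 1) x) x := fun k x => by
    have := (hs.differentiable_iteratedDeriv k (by exact_mod_cast WithTop.coe_lt_top k) x).hasDerivAt
    rwa [← iteratedDeriv_succ] at this
  have h1 : ∀ v ∈ B, ∀ k, ∀ u ∈ B, v ^ k * (D k).comp u ∈ M := by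
    intro v hv k
    induction k with
    | zero =>
      intro u hu
      have : v ^ 0 * (D 0).comp u = h.comp u := by ext x; simp [D]
      rw [this]
      exact Submodule.le_topologicalClosure _ (Submodule.subset_span ⟨u, hu, rfl⟩)
    | succ k ih =>
      intro u hu
      rw [pow_succ]
      have := hasDerivAt_iff_tendsto_slope.1
        (hasDerivAt_mul_comp_add_smul (D k) (D (k + 1)) (hD k) u v (v ^ k))
      refine hMc.mem_of_tendsto this (Filter.Eventually.of_forall fun t => ?_)
      exact M.smul_mem _ (M.sub_mem (ih _ (B.add_mem hu (B.smul_mem _ hv)))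
        (ih _ (B.add_mem hu (B.smul_mem _ hv))))
  have h2 : ∀ v ∈ B, ∀ k, v ^ k ∈ M := by
    intro v hv k
    obtain ⟨b, hb⟩ : ∃ b, D k b ≠ 0 := by
      by_contra! hcon
      exact hp (exists_polynomial_of_iteratedDeriv_eq_zero k h hs hcon)
    have : v ^ k = (D k b)⁻¹ • (v ^ k * (D k).comp (b • (1 : C(X, ℝ)))) := by
      ext x
      simp only [ContinuousMap.smul_apply, ContinuousMap.mul_apply, ContinuousMap.comp_apply,
        ContinuousMap.one_apply, smul_eq_mul, mul_one]
      field_simp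
    rw [this]
    exact M.smul_mem _ (h1 v hv k _ (B.smul_mem _ hone))
  have h3 : ∀ v ∈ B, NormedSpace.exp v ∈ M := by
    intro v hv
    have := NormedSpace.exp_series_hasSum_exp' (𝕂 := ℝ) v
    exact hMc.mem_of_tendsto this (Filter.Eventually.of_forall fun s =>
      M.sum_mem fun k _ => M.smul_mem _ (h2 v hv k))
  -- Since `exp u * exp v = exp (u + v)`, the set `exp '' B` is closed under products, so its linear
  -- span is already an algebra.
  let E : Submonoid C(X, ℝ) :=
    { carrier := NormedSpace.exp '' (B : Set C(X, ℝ))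
      one_mem' := ⟨0, B.zero_mem, NormedSpace.exp_zero⟩
      mul_mem' := by
        rintro _ _ ⟨u, hu, rfl⟩ ⟨v, hv, rfl⟩
        exact ⟨u + v, B.add_mem hu hv, NormedSpace.exp_add⟩ }
  let A := Algebra.adjoin ℝ (E : Set C(X, ℝ))
  have hAM : (A : Set C(X, ℝ)) ⊆ M := by
    have : Subalgebra.toSubmodule A ≤ M := by
      rw [Algebra.adjoin_eq_span, Submonoid.closure_eq, Submodule.span_le]
      rintro _ ⟨v, hv, rfl⟩
      exact h3 v hv
    exact this
  have hAsep : A.SeparatesPoints := by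
    intro x y hxy
    obtain ⟨v, hv, hvxy⟩ := hsep x y hxy
    refine ⟨_, ⟨NormedSpace.exp v, Algebra.subset_adjoin ⟨v, hv, rfl⟩, rfl⟩, ?_⟩
    have hev : ∀ z, NormedSpace.exp v z = Real.exp (v z) := fun z => by
      rw [Real.exp_eq_exp_ℝ]
      exact NormedSpace.map_exp (ContinuousMap.evalAlgHom ℝ ℝ z)
        (continuous_eval_const z) v
    simpa [hev] using hvxy
  have hA := ContinuousMap.subalgebra_topologicalClosure_eq_top_of_separatesPoints A hAsep
  intro f
  have hf : f ∈ closure (A : Set C(X, ℝ)) := by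
    rw [← Subalgebra.topologicalClosure_coe, hA]; trivial
  exact hMc.closure_subset_iff.2 hAM hf

/-! ### Deep networks over an abstract input space -/

/-- The functions computed by the networks with `l` hidden layers and activation `h` whose inputs
are taken from the linear space `B` of functions. -/
def netSpan {X : Type*} [TopologicalSpace X] (h : C(ℝ, ℝ)) (B : Submodule ℝ C(X, ℝ)) :
    ℕ → Submodule ℝ C(X, ℝ)
  | 0 => B
  | l + 1 => Submodule.span ℝ ((fun u => h.comp u) '' (netSpan h B l : Set C(X, ℝ)))

theorem one_mem_netSpan {X : Type*} [TopologicalSpace X] (h : C(ℝ, ℝ)) (hne : ∃ b, h b ≠ 0)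
    (B : Submodule ℝ C(X, ℝ)) (hone : (1 : C(X, ℝ)) ∈ B) (l : ℕ) :
    (1 : C(X, ℝ)) ∈ netSpan h B l := by
  induction l with
  | zero => exact hone
  | succ l ih =>
    obtain ⟨b, hb⟩ := hne
    have : (1 : C(X, ℝ)) = (h b)⁻¹ • h.comp (b • (1 : C(X, ℝ))) := by ext x; simp [hb]
    rw [this]
    exact Submodule.smul_mem _ _ (Submodule.subset_span ⟨_, Submodule.smul_mem _ _ ih, rfl⟩)

/-- A dense set of continuous functions separates the points of a normal Hausdorff space. -/
theorem exists_mem_apply_ne_of_dense {X : Type*} [TopologicalSpace X] [CompactSpace X] [T2Space X]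
    {S : Set C(X, ℝ)} (hS : Dense S) {x y : X} (hxy : x ≠ y) : ∃ f ∈ S, f x ≠ f y := by
  obtain ⟨f, hf0, hf1, -⟩ := exists_continuous_zero_one_of_isClosed
    (isClosed_singleton (x := x)) (isClosed_singleton (x := y))
    (Set.disjoint_singleton.2 hxy)
  have hU : IsOpen {g : C(X, ℝ) | g x ≠ g y} :=
    isOpen_ne_fun (continuous_eval_const x) (continuous_eval_const y)
  obtain ⟨g, hg, hgS⟩ := hS.inter_open_nonempty _ hU
    ⟨f, by simp [hf0 (Set.mem_singleton x), hf1 (Set.mem_singleton y)]⟩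
  exact ⟨g, hgS, hg⟩

/-- Universal approximation by networks with at least one hidden layer. -/
theorem dense_netSpan {X : Type*} [TopologicalSpace X] [CompactSpace X] [T2Space X]
    (h : C(ℝ, ℝ)) (hs : ContDiff ℝ (⊤ : ℕ∞) h)
    (hp : ¬ ∃ p : Polynomial ℝ, ∀ x, h x = p.eval x) (B : Submodule ℝ C(X, ℝ))
    (hone : (1 : C(X, ℝ)) ∈ B) (hsep : ∀ x y, x ≠ y → ∃ v ∈ B, v x ≠ v y) (l : ℕ) (hl : 0 < l) :
    Dense (netSpan h B l : Set C(X, ℝ)) := by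
  have hne : ∃ b, h b ≠ 0 := by
    by_contra! hcon
    exact hp ⟨0, fun x => by simp [hcon]⟩
  induction l, hl using Nat.le_induction with
  | base => exact dense_span_comp h hs hp B hone hsep
  | succ l hl ih =>
    exact dense_span_comp h hs hp _ (one_mem_netSpan h hne B hone l)
      fun x y hxy => exists_mem_apply_ne_of_dense ih hxy

/-! ### From function spaces to networks with explicit weights -/

/-- The inner affine map merges with the first affine layer of `g`, so the depth is unchanged. -/
theorem comp_affine_mem_networks (h : ℝ → ℝ) {n e : ℕ} (W : Matrix (Fin e) (Fin n) ℝ)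
    (b : Fin e → ℝ) (l : ℕ) : ∀ (d : ℕ), ∀ g ∈ networks h l e d,
      (fun x => g (W.mulVec x + b)) ∈ networks h l n d := by
  induction l with
  | zero =>
    rintro d _ ⟨W', b', rfl⟩
    refine ⟨W' * W, W'.mulVec b + b', funext fun x => ?_⟩
    simp [Matrix.mulVec_add, add_assoc]
  | succ l ih =>
    rintro d _ ⟨c, hc, φ, hφ, W', b', rfl⟩
    exact ⟨c, hc, _, ih c φ hφ, W', b', rfl⟩

theorem continuous_of_mem_networks {h : ℝ → ℝ} (hh : Continuous h) {n : ℕ} (l : ℕ) :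
    ∀ (d : ℕ), ∀ g ∈ networks h l n d, Continuous g := by
  induction l with
  | zero =>
    rintro d _ ⟨W, b, rfl⟩
    fun_prop
  | succ l ih =>
    rintro d _ ⟨c, hc, φ, hφ, W, b, rfl⟩
    have := ih c φ hφ
    fun_prop

/-- A tuple of functions in `netSpan h B l` is a network with `l` hidden layers applied to a tuple
of functions in `B`. -/
theorem exists_network_of_mem_netSpan {X : Type*} [TopologicalSpace X] (h : C(ℝ, ℝ))
    (B : Submodule ℝ C(X, ℝ)) (l : ℕ) :
    ∀ (d : ℕ), 0 < d → ∀ φ : Fin d → C(X, ℝ), (∀ i, φ i ∈ netSpan h B l) →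
      ∃ e, 0 < e ∧ ∃ ψ : Fin e → C(X, ℝ), (∀ i, ψ i ∈ B) ∧
        ∃ g ∈ networks h l e d, ∀ x i, φ i x = g (fun i => ψ i x) i := by
  classical
  induction l with
  | zero => exact fun d hd φ hφ => ⟨d, hd, φ, hφ, id, ⟨1, 0, by ext; simp⟩, fun x i => rfl⟩
  | succ l ih =>
    intro d hd φ hφ
    choose T hTS hT using fun i => Submodule.mem_span_finite_of_mem_span (hφ i)
    let U := Finset.univ.biUnion T
    have hU : ∀ u ∈ U, ∃ v ∈ netSpan h B l, h.comp v = u := fun u hu => by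
      obtain ⟨i, -, hi⟩ := Finset.mem_biUnion.1 hu
      exact hTS i hi
    have hφU : ∀ i, ∃ a : C(X, ℝ) → ℝ, ∑ u ∈ U, a u • u = φ i := fun i => by
      have : φ i ∈ Submodule.span ℝ (U : Set C(X, ℝ)) :=
        Submodule.span_mono (by
          exact_mod_cast Finset.subset_biUnion_of_mem T (Finset.mem_univ i)) (hT i)
      obtain ⟨a, -, ha⟩ := Submodule.mem_span_finset.1 this
      exact ⟨a, ha⟩
    choose a ha using hφU
    choose v hv hvu using fun u : U => hU u u.2
    let ε := U.equivFin.symm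
    -- The extra zero neuron, given outgoing weight `0`, keeps the width positive when `U` is empty.
    let V : Fin (U.card + 1) → C(X, ℝ) := Fin.cons 0 fun i => v (ε i)
    have hV : ∀ i, V i ∈ netSpan h B l := Fin.cases (Submodule.zero_mem _) fun i => hv _
    obtain ⟨e, he, ψ, hψ, g, hg, hgV⟩ := ih _ (Nat.succ_pos _) V hV
    refine ⟨e, he, ψ, hψ, _, ⟨U.card + 1, Nat.succ_pos _, g, hg,
      Matrix.of fun i => Fin.cons 0 fun s => a i (ε s), 0, rfl⟩, fun x i => ?_⟩
    simp only [add_zero, Matrix.mulVec, dotProduct, Matrix.of_apply, Fin.sum_univ_succ,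
      Fin.cons_zero, zero_mul, zero_add, Fin.cons_succ, ← hgV, ← ha i]
    rw [ContinuousMap.coe_sum, Finset.sum_apply, ← Finset.sum_coe_sort U,
      ← Equiv.sum_comp ε]
    refine Finset.sum_congr rfl fun s _ => ?_
    have hs : (ε s : C(X, ℝ)) x = h (V s.succ x) := by
      rw [← hvu (ε s)]
      rfl
    rw [ContinuousMap.smul_apply, smul_eq_mul, hs]

/-- The restrictions to `K` of the affine functions on `ℝⁿ`. -/
def affineFunctions {n : ℕ} (K : Compacts (Fin n → ℝ)) : Submodule ℝ C(K, ℝ) where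
  carrier := {F | ∃ (w : Fin n → ℝ) (b : ℝ), ∀ x : K, F x = w ⬝ᵥ (x : Fin n → ℝ) + b}
  zero_mem' := ⟨0, 0, fun x => by simp⟩
  add_mem' := by
    rintro F G ⟨w, b, hF⟩ ⟨w', b', hG⟩
    exact ⟨w + w', b + b', fun x => by
      rw [ContinuousMap.add_apply, hF, hG, add_dotProduct]; ring⟩
  smul_mem' := by
    rintro c F ⟨w, b, hF⟩
    exact ⟨c • w, c * b, fun x => by
      rw [ContinuousMap.smul_apply, hF, smul_dotProduct, smul_eq_mul, smul_eq_mul]; ring⟩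

theorem dense_netSpan_affineFunctions {n : ℕ} (K : Compacts (Fin n → ℝ))
    (h : C(ℝ, ℝ)) (hs : ContDiff ℝ (⊤ : ℕ∞) h)
    (hp : ¬ ∃ p : Polynomial ℝ, ∀ x, h x = p.eval x) (l : ℕ) (hl : 0 < l) :
    Dense (netSpan h (affineFunctions K) l : Set C(K, ℝ)) := by
  refine dense_netSpan h hs hp (affineFunctions K)
    (show ∃ (w : Fin n → ℝ) (b : ℝ), ∀ x : K, (1 : C(K, ℝ)) x = w ⬝ᵥ (x : Fin n → ℝ) + b from
      ⟨0, 1, fun x => by simp⟩) (fun x y hxy => ?_) l hl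
  obtain ⟨i, hi⟩ : ∃ i, (x : Fin n → ℝ) i ≠ (y : Fin n → ℝ) i := by
    by_contra! hcon
    exact hxy (Subtype.ext (funext hcon))
  exact ⟨⟨fun x => (x : Fin n → ℝ) i, (continuous_apply i).comp continuous_subtype_val⟩,
    ⟨Pi.single i 1, 0, fun x => by simp⟩, hi⟩

theorem exists_mem_networks_of_mem_netSpan {n : ℕ} (K : Compacts (Fin n → ℝ)) (h : C(ℝ, ℝ))
    (l : ℕ) {d : ℕ} (hd : 0 < d) (φ : Fin d → C(K, ℝ))
    (hφ : ∀ i, φ i ∈ netSpan h (affineFunctions K) l) :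
    ∃ f ∈ networks h l n d, ∀ (x : K) i, φ i x = f x i := by
  obtain ⟨e, -, ψ, hψ, g, hg, hgφ⟩ := exists_network_of_mem_netSpan h _ l d hd φ hφ
  choose w b hwb using hψ
  refine ⟨_, comp_affine_mem_networks h (Matrix.of w) b l d g hg, fun x i => ?_⟩
  rw [hgφ x i]
  congr 2
  ext i
  exact hwb i x

/-! ### Expectations as input functions on the product of the `𝒫(K_j)` -/

/-- The continuous function `P ↦ E_{P_j}[f]` on `∏ⱼ 𝒫(K_j)`. -/
noncomputable def expectation {k : ℕ} {n : Fin k → ℕ} (K : ∀ j, Compacts (Fin (n j) → ℝ)) (j : Fin k)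
    (f : C(K j, ℝ)) : C(∀ j, ProbabilityMeasure (K j), ℝ) where
  toFun P := ∫ x, f x ∂(P j : Measure (K j))
  continuous_toFun := by
    have : Continuous fun p : ProbabilityMeasure (K j) => ∫ x, f x ∂(p : Measure (K j)) :=
      continuous_iff_continuousAt.2 fun p =>
        ProbabilityMeasure.tendsto_iff_forall_integral_tendsto.1 Filter.tendsto_id
          (BoundedContinuousFunction.mkOfCompact f)
    exact this.comp (continuous_apply j)

theorem integrable_of_compactSpace {X : Type*} [TopologicalSpace X] [CompactSpace X]
    [MeasurableSpace X] [OpensMeasurableSpace X] (μ : Measure X) [IsFiniteMeasure μ] (f : C(X, ℝ)) :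
    Integrable f μ :=
  (BoundedContinuousFunction.mkOfCompact f).integrable μ

/-- The functions `P ↦ ∑ⱼ E_{P_j}[f_j] + c` with networks `f_j` that have `L j` hidden layers. -/
noncomputable def expectationFunctions {k : ℕ} {n : Fin k → ℕ} (K : ∀ j, Compacts (Fin (n j) → ℝ))
    (h : C(ℝ, ℝ)) (L : Fin k → ℕ) : Submodule ℝ C(∀ j, ProbabilityMeasure (K j), ℝ) where
  carrier := {F | ∃ f : ∀ j, C(K j, ℝ), (∀ j, f j ∈ netSpan h (affineFunctions (K j)) (L j)) ∧
    ∃ c : ℝ, ∀ P, F P = ∑ j, expectation K j (f j) P + c}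
  zero_mem' := ⟨0, fun j => Submodule.zero_mem _, 0, fun P => by simp [expectation]⟩
  add_mem' := by
    rintro F G ⟨f, hf, c, hF⟩ ⟨f', hf', c', hG⟩
    refine ⟨f + f', fun j => Submodule.add_mem _ (hf j) (hf' j), c + c', fun P => ?_⟩
    have : ∀ j, expectation K j ((f + f') j) P
        = expectation K j (f j) P + expectation K j (f' j) P := fun j =>
      integral_add (integrable_of_compactSpace _ _) (integrable_of_compactSpace _ _)
    rw [ContinuousMap.add_apply, hF, hG, Finset.sum_congr rfl fun j _ => this j,
      Finset.sum_add_distrib]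
    ring
  smul_mem' := by
    rintro a F ⟨f, hf, c, hF⟩
    refine ⟨a • f, fun j => Submodule.smul_mem _ _ (hf j), a * c, fun P => ?_⟩
    have : ∀ j, expectation K j ((a • f) j) P = a * expectation K j (f j) P := fun j =>
      integral_const_mul a _
    rw [ContinuousMap.smul_apply, hF, Finset.sum_congr rfl fun j _ => this j, ← Finset.mul_sum,
      smul_eq_mul, mul_add]

theorem exists_expectationFunctions_apply_ne {k : ℕ} {n : Fin k → ℕ}
    (K : ∀ j, Compacts (Fin (n j) → ℝ)) (h : C(ℝ, ℝ)) (L : Fin k → ℕ)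
    (hdense : ∀ j, Dense (netSpan h (affineFunctions (K j)) (L j) : Set C(K j, ℝ)))
    {P Q : ∀ j, ProbabilityMeasure (K j)} (hPQ : P ≠ Q) :
    ∃ F ∈ expectationFunctions K h L, F P ≠ F Q := by
  obtain ⟨j, hj⟩ := Function.ne_iff.1 hPQ
  obtain ⟨f, hf⟩ : ∃ f : C(K j, ℝ), expectation K j f P ≠ expectation K j f Q := by
    by_contra! hcon
    have hμ : (P j : Measure (K j)) = (Q j : Measure (K j)) :=
      ext_of_forall_integral_eq_of_IsFiniteMeasure fun f => hcon f.toContinuousMap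
    exact hj (Subtype.ext hμ)
  -- Separating `P` from `Q` is thus an open condition on `f`, so a network near `f` also satisfies
  -- it.
  have hcont : ∀ P, Continuous fun f => expectation K j f P := fun P => by
    have hL : LipschitzWith 1 fun f => expectation K j f P := by
      refine LipschitzWith.of_dist_le_mul fun f g => ?_
      have hsub : expectation K j f P - expectation K j g P
          = ∫ x, (f - g) x ∂(P j : Measure (K j)) :=
        (integral_sub (integrable_of_compactSpace _ f) (integrable_of_compactSpace _ g)).symm
      rw [Real.dist_eq, hsub, ← Real.norm_eq_abs, dist_eq_norm, NNReal.coe_one, one_mul]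
      simpa using norm_integral_le_of_norm_le_const (μ := (P j : Measure (K j)))
        (Filter.Eventually.of_forall fun x => (f - g).norm_coe_le_norm x)
    exact hL.continuous
  obtain ⟨g, hg, hgN⟩ := (hdense j).inter_open_nonempty _ (isOpen_ne_fun (hcont P) (hcont Q)) ⟨f, hf⟩
  have hmem : ∀ i, Pi.single (M := fun j => C(K j, ℝ)) j g i
      ∈ netSpan h (affineFunctions (K i)) (L i) := fun i => by
    rcases eq_or_ne i j with rfl | hi
    · simpa using hgN
    · simp [hi]
  have hsum : ∀ R, ∑ i, expectation K i (Pi.single (M := fun j => C(K j, ℝ)) j g i) R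
      = expectation K j g R := fun R => by
    rw [Finset.sum_eq_single j (fun i _ hi => by simp [hi, expectation]) (by simp)]
    simp
  exact ⟨expectation K j g, ⟨_, hmem, 0, fun R => by rw [hsum, add_zero]⟩, hg⟩

theorem sum_concat {k : ℕ} {m : Fin k → ℕ} (v w : ∀ j, Fin (m j) → ℝ) :
    ∑ p, concat w p * concat v p = ∑ j, ∑ i, w j i * v j i := by
  rw [← Equiv.sum_comp finSigmaFinEquiv, Fintype.sum_sigma]
  refine Finset.sum_congr rfl fun j _ => Finset.sum_congr rfl fun i _ => ?_
  simp only [concat]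
  rw [Equiv.symm_apply_apply]

theorem integral_apply_eq_expectation {k : ℕ} {n : Fin k → ℕ} (K : ∀ j, Compacts (Fin (n j) → ℝ))
    (P : ∀ j, ProbabilityMeasure (K j)) (j : Fin k) {d : ℕ} {f : (Fin (n j) → ℝ) → (Fin d → ℝ)}
    (φ : Fin d → C(K j, ℝ)) (hφ : ∀ (x : K j) i, φ i x = f x i) (i : Fin d) :
    (∫ x : K j, f x ∂(P j : Measure (K j))) i = expectation K j (φ i) P := by
  rw [eval_integral fun i => by
    simpa only [← hφ] using integrable_of_compactSpace (P j : Measure (K j)) (φ i)]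
  simp only [← hφ]
  rfl

/-- Each of the `e` inputs of the outer network is a sum over `j` of expectations, plus a constant.
For fixed `j`, the `e` integrands are stacked into one network with `m j = e` outputs; the sums over
`j` and the constants are absorbed into the first affine layer of the outer network. -/
theorem mem_measureNetworks_of_mem_netSpan {k : ℕ} {n : Fin k → ℕ}
    (K : ∀ j, Compacts (Fin (n j) → ℝ)) (h : C(ℝ, ℝ)) (l : ℕ) (L : Fin k → ℕ)
    (F : C(∀ j, ProbabilityMeasure (K j), ℝ))
    (hF : F ∈ netSpan h (expectationFunctions K h L) l) : ⇑F ∈ measureNetworks h K l L := by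
  obtain ⟨e, he, ψ, hψ, g, hg, hgF⟩ :=
    exists_network_of_mem_netSpan h _ l 1 one_pos (fun _ => F) fun _ => hF
  choose φ hφ c hψφ using hψ
  choose f hf hfφ using fun j =>
    exists_mem_networks_of_mem_netSpan (K j) h (L j) he (fun i => φ i j) fun i => hφ i j
  refine ⟨fun _ => e, fun _ => he, f, hf, _, comp_affine_mem_networks h
    -- Row `i` selects the `i`-th coordinate of every block and adds them up.
    (Matrix.of fun i => concat fun _ => Pi.single i 1) c l 1 g hg, fun P => ?_⟩
  rw [hgF P 0]
  congr 2
  ext i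
  rw [hψφ, Pi.add_apply, Matrix.mulVec, dotProduct]
  simp only [Matrix.of_apply]
  rw [sum_concat]
  congr 1
  refine Finset.sum_congr rfl fun j _ => ?_
  simp only [integral_apply_eq_expectation K P j (fun i => φ i j) (hfφ j)]
  simp [Pi.single_apply]

theorem continuous_of_mem_measureNetworks {h : ℝ → ℝ} (hh : Continuous h) {k : ℕ} {n : Fin k → ℕ}
    (K : ∀ j, Compacts (Fin (n j) → ℝ)) (l : ℕ) (L : Fin k → ℕ)
    (H : (∀ j, ProbabilityMeasure (K j)) → ℝ) (hH : H ∈ measureNetworks h K l L) :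
    Continuous H := by
  obtain ⟨m, -, f, hf, g, hg, hHg⟩ := hH
  have hfc := fun j => continuous_of_mem_networks hh _ _ (f j) (hf j)
  have hgc := continuous_of_mem_networks hh _ _ g hg
  let φ : ∀ j, Fin (m j) → C(K j, ℝ) := fun j i => ⟨fun x => f j x i, by fun_prop⟩
  rw [funext hHg]
  refine (continuous_apply 0).comp (hgc.comp (continuous_pi fun p => ?_))
  simp only [concat, integral_apply_eq_expectation K _ _ (φ _) fun x i => rfl]
  exact ContinuousMap.continuous _

/-- The first conjunct says that the functions in question are continuous, so that they form a
subset of `C(∏ⱼ 𝒫(K_j), ℝ)`; the second that this subset is dense. `ProbabilityMeasure` carries the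
topology of weak convergence, and as `∏ⱼ 𝒫(K_j)` is a compact space, the topology of
`C(∏ⱼ 𝒫(K_j), ℝ)` is that of the uniform norm. -/
theorem theorem5p1 (h : ℝ → ℝ) (h_analytic : AnalyticOnNhd ℝ h Set.univ)
    (h_lipschitz : ∃ C : NNReal, LipschitzWith C h)
    (h_nonpoly : ¬ ∃ p : Polynomial ℝ, ∀ x, h x = p.eval x)
    (k : ℕ) (n : Fin k → ℕ) (K : ∀ j, TopologicalSpace.Compacts (Fin (n j) → ℝ))
    (l : ℕ) (hl : 0 < l) (L : Fin k → ℕ) (hL : ∀ j, 0 < L j) :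
    (∀ H ∈ measureNetworks h K l L, Continuous H) ∧
      Dense {F : C(∀ j, MeasureTheory.ProbabilityMeasure (K j), ℝ) |
        ⇑F ∈ measureNetworks h K l L} := by
  have hh : Continuous h := continuous_iff_continuousAt.2 fun x => (h_analytic x trivial).continuousAt
  have hs : ContDiff ℝ (⊤ : ℕ∞) h := h_analytic.contDiff
  refine ⟨continuous_of_mem_measureNetworks hh K l L, ?_⟩
  let h' : C(ℝ, ℝ) := ⟨h, hh⟩
  refine Dense.mono (fun F hF => mem_measureNetworks_of_mem_netSpan K h' l L F hF)
    (dense_netSpan h' hs h_nonpoly (expectationFunctions K h' L) ?_ ?_ l hl)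
  · exact ⟨0, fun j => Submodule.zero_mem _, 1, fun P => by simp [expectation]⟩
  · exact fun P Q => exists_expectationFunctions_apply_ne K h' L fun j =>
      dense_netSpan_affineFunctions (K j) h' hs h_nonpoly (L j) (hL j)
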